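/- **Setting.** A target at a random location $\theta\in\mathbb R^2$ is localized by iterative $M$-ary classification with $M$ and the last iteration index $k^{stop}$ fixed; the iterations are $k=0,\dots,k^{stop}$. A measurable set $ROI_0\subset\mathbb R^2$ is given, and for every $k$ there are centers $\theta^k_0,\dots,\theta^k_{M-1}$. For $0\le j\le M-1$, $R^k_j$ is the set of points of $ROI_k$ that are strictly closer to $\theta^k_j$ than to every other $\theta^k_l$, and $ROI_{k+1}$ is one of the regions $R^k_0,\dots,R^k_{M-1}$ (any choice). The law $\pi$ of the target makes the hypotheses equally likely: $\pi(R^k_j)=M^{-(k+1)}$ for all $k\le k^{stop}$ and all $j$. *Sensors.* Consider a sequence of networks whose number of sensors $N$ tends to infinity; the sensors of a network have locations $L_1,\dots,L_N\in\mathbb R^2$ (which may change with the network). Let $S^k_j$ be the set of sensors lying in $R^k_j$; $|S^k_j|=N/M^{k+1}$ for all $k\le k^{stop}$ and all $j$. The target is almost surely not at the location of a sensor, and no sensor of $S^k_j$ is at $\theta^k_j$. At iteration $k$, sensor $i$ in $ROI_k$ observes $s_i=a_i+w_i$ with $a_i=\sqrt{P_0}/d_i$, where $P_0>0$, $d_i=|\theta-L_i|$,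 and the noises $w_i$ are i.i.d. with a probability law whose complementary distribution function is strictly decreasing. It forms $D_i=1$ if $s_i>\eta^k_i$ and $D_i=0$ otherwise, where $\eta^k_i=\sqrt{P_0}/\min_l|L_i-\theta^k_l|$. Independently, each sensor is Byzantine with probability $\alpha\ge0$; it sends $u_i=D_i$ if it is honest and $u_i=1-D_i$ if it is Byzantine. *Channel and decoding.* The fusion center receives $v_i=h_i(-1)^{u_i}\sqrt{E_b}+n_i$, with $E_b>0$, $h_i$ Rayleigh distributed with variance $\sigma_h^2>0$, and $n_i$ Gaussian with mean zero and variance $\sigma_f^2>0$; given $\theta$, all of the variables $w_i$, $h_i$, $n_i$ and the Byzantine indicators are independent. Let $\psi_i=\ln\frac{p(v_i\mid u_i=0)}{p(v_i\mid u_i=1)}$, where $p(\cdot\mid u)$ is the density of the channel output given the sent bit $u$. Let $c^k_{(j+1)i}=1$ if $i\in S^k_j$ and $0$ otherwise. At iteration $k$ the fusion center decides the $j$ that minimizes $d_F(\psi,c^k_{j+1})=\sum_{i:\,L_i\in ROI_k}\bigl(\psi_i-(-1)^{c^k_{(j+1)i}}\bigr)^2$, ties being broken uniformly at random. The detection probability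 at iteration $k$ is $$P^k_d=\frac1M\sum_{j=0}^{M-1}\int P(\text{decide } j\mid\theta)\,d\pi(\theta\mid\theta\in R^k_j),$$ and $P_D=\prod_{k=0}^{k^{stop}}P^k_d$. *Assumptions on the deployment.* (1) (Symmetry.) For every network, every $k\le k^{stop}$, all $j\ne l$ and every $\theta\in R^k_j$, there is a bijection $f:S^k_j\to S^k_l$ such that $\eta^k_{f(i)}=\eta^k_i$ and $|\theta-L_i|<|\theta-L_{f(i)}|$ for all $i\in S^k_j$. (2) (The sensors fill the region of interest.) For every $x\in ROI_0$ and $\varepsilon>0$ there is $c>0$ such that in all but finitely many of the networks at least $cN$ sensors are at distance less than $\varepsilon$ from $x$. **Theorem.** If $\alpha<1/2$, then $\lim_{N\to\infty}P_D=1$. -/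

import Mathlib

open MeasureTheory ProbabilityTheory Filter Topology
open scoped NNReal ENNReal BigOperators

noncomputable section

namespace TargetLocalization

/-- The plane, with the Euclidean distance. -/
abbrev Plane := EuclideanSpace ℝ (Fin 2)

/-! ### Iterated splitting of the region of interest -/

/-- The data of the iterative zooming: the initial region of interest (ROI), the `M` centers that
split the ROI of iteration `k`, and the index `path k` of the region that becomes the ROI of
iteration `k + 1`. -/
structure Splitting (M : ℕ) where
  roi₀ : Set Plane
  center : ℕ → Fin M → Plane
  path : ℕ → Fin M

namespace Splitting

variable {M : ℕ}

/-- The points of `A` whose unique nearest center of iteration `k` is the one with index `j`. -/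
def cell (Z : Splitting M) (k : ℕ) (j : Fin M) (A : Set Plane) : Set Plane :=
  {x | x ∈ A ∧ ∀ l, l ≠ j → dist x (Z.center k j) < dist x (Z.center k l)}

/-- The region of interest at iteration `k`. -/
def roi (Z : Splitting M) : ℕ → Set Plane
  | 0 => Z.roi₀
  | k + 1 => Z.cell k (Z.path k) (Z.roi k)

/-- The region of hypothesis `j` at iteration `k`. -/
def region (Z : Splitting M) (k : ℕ) (j : Fin M) : Set Plane :=
  Z.cell k j (Z.roi k)

/-- The sensors (located at `L i`) lying in the region of hypothesis `j` at iteration `k`. -/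
def sensors (Z : Splitting M) {N : ℕ} (L : Fin N → Plane) (k : ℕ) (j : Fin M) :
    Finset (Fin N) :=
  open Classical in Finset.univ.filter fun i => L i ∈ Z.region k j

/-- The sensors lying in the region of interest at iteration `k`. -/
def activeSensors (Z : Splitting M) {N : ℕ} (L : Fin N → Plane) (k : ℕ) : Finset (Fin N) :=
  open Classical in Finset.univ.filter fun i => L i ∈ Z.roi k

/-- The code matrix of iteration `k`: row `j` has a one exactly at the sensors of region `j`. -/
def code (Z : Splitting M) {N : ℕ} (L : Fin N → Plane) (k : ℕ) (j : Fin M) (i : Fin N) : Bool :=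
  open Classical in decide (L i ∈ Z.region k j)

/-- Threshold at iteration `k` of a sensor located at `x`: the amplitude that would be received
from a target located at the center of the sensor's own region, i.e. at its nearest center. -/
def threshold (Z : Splitting M) (P₀ : ℝ) (k : ℕ) (x : Plane) : ℝ :=
  √P₀ / ⨅ l, dist x (Z.center k l)

/-- The symmetry assumption, up to iteration `kmax`: for every target location in a region there
is a bijection onto the sensors of any other region that preserves the threshold and strictly
increases the distance to the target. -/
def SymmetricPairing (Z : Splitting M) (P₀ : ℝ) (kmax : ℕ) {N : ℕ} (L : Fin N → Plane) : Prop :=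
  ∀ k ≤ kmax, ∀ j l : Fin M, l ≠ j → ∀ θ ∈ Z.region k j,
    ∃ f : Z.sensors L k j ≃ Z.sensors L k l, ∀ i : Z.sensors L k j,
      Z.threshold P₀ k (L i) = Z.threshold P₀ k (L (f i)) ∧
        dist θ (L i) < dist θ (L (f i))

end Splitting

/-! ### Sensing, Byzantine attack and fading channel -/

/-- Signal amplitude at a sensor located at `x` when the target is at `θ` (path loss exponent `2`,
reference distance `1`, power `P₀` at the reference distance). -/
def amplitude (P₀ : ℝ) (θ x : Plane) : ℝ := √P₀ / dist θ x

/-- The square of the scale of the Rayleigh distribution whose variance is `σh2`. -/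
def rayleighScaleSq (σh2 : ℝ) : ℝ := 2 * σh2 / (4 - Real.pi)

/-- The Rayleigh distribution with variance `σh2`. -/
def rayleigh (σh2 : ℝ) : Measure ℝ :=
  (volume.restrict (Set.Ioi 0)).withDensity fun h =>
    ENNReal.ofReal (h / rayleighScaleSq σh2 * Real.exp (-h ^ 2 / (2 * rayleighScaleSq σh2)))

/-- The Bernoulli distribution: `true` with probability `α`, `false` with probability `1 - α`. -/
def coin (α : ℝ) : Measure Bool :=
  ENNReal.ofReal α • Measure.dirac true + ENNReal.ofReal (1 - α) • Measure.dirac false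

/-- The antipodal symbol `(-1) ^ b`. -/
def antipodal (b : Bool) : ℝ := if b then -1 else 1

/-- The physical parameters: source power `P₀`, law `noise` of the sensor noise, fraction `α` of
Byzantines, energy per channel bit `Eb`, variance `σh2` of the fading coefficients and variance
`σf2` of the channel noise. -/
structure Model where
  P₀ : ℝ
  noise : Measure ℝ
  α : ℝ
  Eb : ℝ
  σh2 : ℝ
  σf2 : ℝ≥0

/-- The randomness at one sensor: observation noise, whether the sensor is Byzantine, fading
coefficient, channel noise. -/
abbrev Sample := ℝ × Bool × ℝ × ℝ

namespace Model

/-- The four sources of randomness at a sensor are independent. -/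
def sampleLaw (S : Model) : Measure Sample :=
  S.noise.prod ((coin S.α).prod ((rayleigh S.σh2).prod (gaussianReal 0 S.σf2)))

/-- The bit sent by a sensor with amplitude `a` and threshold `η`: the quantized observation,
flipped if the sensor is Byzantine. -/
def sentBit (a η : ℝ) (ω : Sample) : Bool := xor (decide (η < a + ω.1)) ω.2.1

/-- The channel output received from this sensor. -/
def received (S : Model) (a η : ℝ) (ω : Sample) : ℝ :=
  ω.2.2.1 * antipodal (sentBit a η ω) * √S.Eb + ω.2.2.2

/-- The density at `v` of the channel output when the bit `u` is sent. -/
def likelihood (S : Model) (u : Bool) (v : ℝ) : ℝ :=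
  ∫ h, gaussianPDFReal (h * antipodal u * √S.Eb) S.σf2 v ∂(rayleigh S.σh2)

/-- The reliability (log-likelihood ratio) of a received value. -/
def reliability (S : Model) (v : ℝ) : ℝ :=
  Real.log (S.likelihood false v / S.likelihood true v)

end Model

/-! ### Soft-decision decoding and detection probability -/

section Decoding

variable {M N : ℕ}

/-- The `F`-distance between a reliability vector and row `j` of the code matrix. -/
def fDist (Z : Splitting M) (L : Fin N → Plane) (k : ℕ) (ψ : Fin N → ℝ) (j : Fin M) : ℝ :=
  ∑ i ∈ Z.activeSensors L k, (ψ i - antipodal (Z.code L k j i)) ^ 2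

/-- The hypotheses that minimize the `F`-distance. -/
def minimizers (Z : Splitting M) (L : Fin N → Plane) (k : ℕ) (ψ : Fin N → ℝ) : Finset (Fin M) :=
  open Classical in Finset.univ.filter fun j => ∀ l, fDist Z L k ψ j ≤ fDist Z L k ψ l

/-- Conditional probability, given the reliabilities, that hypothesis `j` is decided; ties are
broken uniformly at random. -/
def reward (Z : Splitting M) (L : Fin N → Plane) (k : ℕ) (j : Fin M) (ψ : Fin N → ℝ) : ℝ :=
  open Classical in
  if j ∈ minimizers Z L k ψ then 1 / ((minimizers Z L k ψ).card : ℝ) else 0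

/-- Probability that hypothesis `j` is decided at iteration `k` when the target is at `θ`; given
`θ`, the sensors are independent. -/
def decideProb (S : Model) (Z : Splitting M) (L : Fin N → Plane) (k : ℕ) (j : Fin M)
    (θ : Plane) : ℝ :=
  ∫ ω : Fin N → Sample,
    reward Z L k j (fun i =>
      S.reliability (S.received (amplitude S.P₀ θ (L i)) (Z.threshold S.P₀ k (L i)) (ω i)))
    ∂(Measure.pi fun _ => S.sampleLaw)

/-- Detection probability at iteration `k`, for the law `π` of the target: the `M` hypotheses are
equally likely, and under hypothesis `j` the target has law `π` conditioned on region `j`. -/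
def detectionProbAt (S : Model) (Z : Splitting M) (π : Measure Plane) (L : Fin N → Plane)
    (k : ℕ) : ℝ :=
  (1 / (M : ℝ)) * ∑ j, ∫ θ, decideProb S Z L k j θ ∂(ProbabilityTheory.cond π (Z.region k j))

/-- Overall detection probability of the target region. -/
def detectionProb (S : Model) (Z : Splitting M) (π : Measure Plane) (kmax : ℕ)
    (L : Fin N → Plane) : ℝ :=
  ∏ k ∈ Finset.range (kmax + 1), detectionProbAt S Z π L k

end Decoding

end TargetLocalization

end

namespace TargetLocalization

/-! ### The Rayleigh distribution and the coin -/

/-! After expanding the squares, the decoder picks a region whose sensors have the least total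
reliability (`fDist_eq`). Reliability is an odd function of the channel output and positive on
positive outputs, so its mean is some μ > 0 when bit 0 is sent and -μ when bit 1 is sent
(`meanReliability_pos`, `integral_reliability_channelOutput_eq`). A sensor with amplitude a and
threshold η therefore has mean reliability μ(1 - 2α)(1 - 2F(η - a)), with F the complementary
distribution function of the noise (`integral_sensorReliability`). For α < 1/2 this strictly
decreases in a.

Fix a target θ in region j. The symmetry assumption pairs each sensor of region j with a farther one
of region l having the same threshold, so every pair pulls the mean totals in the right direction.
The total gap must be of order N, which strict monotonicity alone does not give. It comes from the
sensors close to θ: their amplitudes are huge, while their partners lie outside region j and hence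
at distance at least some r from θ, so each such pair gains a fixed amount (`exists_tail_gap`). The
density assumption provides at least cN of these pairs (`Splitting.exists_sum_gap`).

Reliabilities have uniformly bounded variance, so Chebyshev's inequality and a union bound over the
wrong regions leave an error probability O(1/N) (`one_sub_le_decideProb`). The constants depend on
θ; dominated convergence passes to the average over θ, and a finite product of limits concludes. -/

lemma rayleighScaleSq_pos {σh2 : ℝ} (h : 0 < σh2) : 0 < rayleighScaleSq σh2 := by
  have := Real.pi_lt_four
  unfold rayleighScaleSq
  have : 0 < 4 - Real.pi := by linarith
  positivity

lemma isProbabilityMeasure_coin {α : ℝ} (h0 : 0 ≤ α) (h1 : α ≤ 1) :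
    IsProbabilityMeasure (coin α) := by
  constructor
  simp only [coin, Measure.coe_add, Measure.coe_smul, Pi.add_apply, Pi.smul_apply, measure_univ,
    smul_eq_mul, mul_one]
  rw [← ENNReal.ofReal_add h0 (by linarith)]
  simp

lemma integral_coin {α : ℝ} (h0 : 0 ≤ α) (h1 : α ≤ 1) (f : Bool → ℝ) :
    ∫ b, f b ∂(coin α) = α * f true + (1 - α) * f false := by
  unfold coin
  have h : ∀ (c : ℝ) (b : Bool), Integrable f (ENNReal.ofReal c • Measure.dirac b) := fun c b =>
    (integrable_dirac (by simp)).smul_measure ENNReal.ofReal_ne_top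
  rw [integral_add_measure (h _ _) (h _ _), integral_smul_measure, integral_smul_measure, integral_dirac, integral_dirac,
    ENNReal.toReal_ofReal h0, ENNReal.toReal_ofReal (by linarith)]
  simp

lemma isProbabilityMeasure_rayleigh {σh2 : ℝ} (h : 0 < σh2) :
    IsProbabilityMeasure (rayleigh σh2) := by
  have hs := rayleighScaleSq_pos h
  set s := rayleighScaleSq σh2 with hsdef
  have hI := integral_rpow_mul_exp_neg_mul_rpow (p := 2) (q := 1) (b := 1 / (2 * s))
    (by norm_num) (by norm_num) (by positivity)
  have heq : ∀ x : ℝ, x / s * Real.exp (-x ^ 2 / (2 * s))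
      = s⁻¹ * (x ^ (1 : ℝ) * Real.exp (-(1 / (2 * s)) * x ^ (2 : ℝ))) := by
    intro x
    rw [Real.rpow_one, Real.rpow_two]
    ring_nf
  have hint : IntegrableOn (fun x : ℝ => x / s * Real.exp (-x ^ 2 / (2 * s))) (Set.Ioi 0) := by
    have := (integrable_rpow_mul_exp_neg_mul_sq (b := 1 / (2 * s)) (by positivity)
      (s := 1) (by norm_num)).integrableOn (s := Set.Ioi 0)
    simp_rw [heq]
    simpa only [Real.rpow_two, IntegrableOn] using this.const_mul s⁻¹
  constructor
  rw [rayleigh, withDensity_apply _ MeasurableSet.univ, Measure.restrict_univ, ← hsdef,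
    ← ofReal_integral_eq_lintegral_ofReal hint]
  · simp_rw [heq]
    rw [integral_const_mul, hI]
    norm_num
    rw [Real.rpow_neg_one]
    field_simp
  · filter_upwards [ae_restrict_mem measurableSet_Ioi] with x hx
    have : 0 < x := hx
    simp only [Pi.zero_apply]
    positivity

lemma rayleigh_ae_pos (σh2 : ℝ) : ∀ᵐ h ∂(rayleigh σh2), 0 < h :=
  (withDensity_absolutelyContinuous _ _).ae_le (ae_restrict_mem measurableSet_Ioi)

/-- Reliabilities grow quadratically in the channel output, so bounding their variance takes fourth
moments of the fading and of the channel noise. -/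
lemma memLp_sq_rayleigh {σh2 : ℝ} (h : 0 < σh2) :
    MemLp (fun x : ℝ => x ^ 2) 2 (rayleigh σh2) := by
  have hs := rayleighScaleSq_pos h
  rw [memLp_two_iff_integrable_sq (by fun_prop), rayleigh,
    integrable_withDensity_iff_integrable_smul' (by fun_prop) (by simp)]
  -- The exponent 5 is the fourth power times the linear factor of the Rayleigh density.
  have := ((integrable_rpow_mul_exp_neg_mul_sq (b := 1 / (2 * rayleighScaleSq σh2))
    (by positivity) (s := 5) (by norm_num)).integrableOn (s := Set.Ioi 0)).const_mul
      (rayleighScaleSq σh2)⁻¹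
  refine this.congr ?_
  filter_upwards [ae_restrict_mem measurableSet_Ioi] with x hx
  have hx' : 0 < x := hx
  rw [ENNReal.toReal_ofReal (by positivity), smul_eq_mul,
    show (5 : ℝ) = (5 : ℕ) by norm_num, Real.rpow_natCast]
  ring_nf

/-! ### The likelihoods of the channel output -/

namespace Model

variable {S : Model}

lemma gaussianPDFReal_le (m : ℝ) (s : ℝ≥0) (v : ℝ) :
    gaussianPDFReal m s v ≤ (√(2 * Real.pi * s))⁻¹ := by
  rw [gaussianPDFReal]
  refine mul_le_of_le_one_right (by positivity) (Real.exp_le_one_iff.2 ?_)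
  rw [neg_div]
  exact neg_nonpos.2 (by positivity)

lemma measurable_gaussianPDFReal_uncurry (s : ℝ≥0) :
    Measurable (fun p : ℝ × ℝ => gaussianPDFReal p.1 s p.2) := by
  unfold gaussianPDFReal
  fun_prop

lemma integrable_likelihood (hσh : 0 < S.σh2) (u : Bool) (v : ℝ) :
    Integrable (fun h => gaussianPDFReal (h * antipodal u * √S.Eb) S.σf2 v) (rayleigh S.σh2) := by
  have := isProbabilityMeasure_rayleigh hσh
  refine Integrable.of_bound (C := (√(2 * Real.pi * S.σf2))⁻¹) ?_ (ae_of_all _ fun h => ?_)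
  · exact ((measurable_gaussianPDFReal_uncurry S.σf2).comp
      (f := fun h : ℝ => (h * antipodal u * √S.Eb, v)) (by fun_prop)).aestronglyMeasurable
  · rw [Real.norm_of_nonneg (gaussianPDFReal_nonneg _ _ _)]
    exact gaussianPDFReal_le _ _ _

lemma measurable_likelihood (hσh : 0 < S.σh2) (u : Bool) : Measurable (S.likelihood u) := by
  have := isProbabilityMeasure_rayleigh hσh
  refine StronglyMeasurable.measurable ?_
  refine StronglyMeasurable.integral_prod_right
    (f := fun v h => gaussianPDFReal (h * antipodal u * √S.Eb) S.σf2 v) ?_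
  exact ((measurable_gaussianPDFReal_uncurry S.σf2).comp
    (f := fun p : ℝ × ℝ => (p.2 * antipodal u * √S.Eb, p.1)) (by fun_prop)).stronglyMeasurable

lemma measurable_reliability (hσh : 0 < S.σh2) : Measurable S.reliability :=
  Real.measurable_log.comp ((measurable_likelihood hσh _).div (measurable_likelihood hσh _))

lemma likelihood_true (v : ℝ) : S.likelihood true v = S.likelihood false (-v) := by
  unfold likelihood
  congr 1
  ext h
  simp only [antipodal, gaussianPDFReal]
  simp only [if_true, Bool.false_eq_true, if_false]
  ring_nf

/-- Since (v - m)² ≤ 2v² + 2m², the Gaussian kernel dominates a product of a function of v and a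
function of m. The constant q is the average of the latter over the fading. -/
lemma exists_le_likelihood (hσh : 0 < S.σh2) (hσf : 0 < S.σf2) :
    ∃ q : ℝ, 0 < q ∧ ∀ v, (√(2 * Real.pi * S.σf2))⁻¹ * (q * Real.exp (-(v ^ 2 / S.σf2)))
      ≤ S.likelihood false v := by
  have hP := isProbabilityMeasure_rayleigh hσh
  have hs : (0 : ℝ) < S.σf2 := by exact_mod_cast hσf
  have hint : Integrable (fun h : ℝ => Real.exp (-((h * √S.Eb) ^ 2 / S.σf2)))
      (rayleigh S.σh2) := by
    refine Integrable.of_bound (C := 1) (by fun_prop) (ae_of_all _ fun h => ?_)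
    rw [Real.norm_of_nonneg (Real.exp_pos _).le, Real.exp_le_one_iff]
    exact neg_nonpos.2 (by positivity)
  refine ⟨∫ h, Real.exp (-((h * √S.Eb) ^ 2 / S.σf2)) ∂(rayleigh S.σh2),
    integral_exp_pos hint, fun v => ?_⟩
  rw [← integral_mul_const, ← integral_const_mul]
  refine integral_mono ((hint.mul_const _).const_mul _) (integrable_likelihood hσh false v)
    fun h => ?_
  simp only [gaussianPDFReal]
  refine mul_le_mul_of_nonneg_left ?_ (by positivity)
  rw [← Real.exp_add]
  refine Real.exp_le_exp.2 ?_
  simp only [antipodal, Bool.false_eq_true, if_false, mul_one]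
  rw [← neg_add, neg_div, neg_le_neg_iff, ← add_div, div_le_div_iff₀ (by positivity) hs]
  nlinarith [mul_nonneg hs.le (sq_nonneg (v + h * √S.Eb))]

lemma likelihood_pos (hσh : 0 < S.σh2) (hσf : 0 < S.σf2) (u : Bool) (v : ℝ) :
    0 < S.likelihood u v := by
  have hs : (0 : ℝ) < S.σf2 := by exact_mod_cast hσf
  obtain ⟨q, hq, h⟩ := exists_le_likelihood hσh hσf
  have key : ∀ v, 0 < S.likelihood false v := fun v =>
    lt_of_lt_of_le (by positivity) (h v)
  cases u
  · exact key v
  · rw [likelihood_true]; exact key _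

lemma likelihood_le (hσh : 0 < S.σh2) (u : Bool) (v : ℝ) :
    S.likelihood u v ≤ (√(2 * Real.pi * S.σf2))⁻¹ := by
  have hP := isProbabilityMeasure_rayleigh hσh
  have := integral_mono (integrable_likelihood hσh u v)
    (integrable_const (μ := rayleigh S.σh2) (√(2 * Real.pi * S.σf2))⁻¹)
    (fun h => gaussianPDFReal_le _ _ _)
  simpa [likelihood] using this

lemma reliability_neg (v : ℝ) : S.reliability (-v) = -S.reliability v := by
  simp only [reliability, likelihood_true, neg_neg]
  rw [← Real.log_inv, inv_div]

/-- Reliabilities grow at most quadratically. -/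
lemma exists_abs_reliability_le (hσh : 0 < S.σh2) (hσf : 0 < S.σf2) :
    ∃ C : ℝ, 0 ≤ C ∧ ∀ v, |S.reliability v| ≤ v ^ 2 / S.σf2 + C := by
  have hs : (0 : ℝ) < S.σf2 := by exact_mod_cast hσf
  obtain ⟨q, hq, hle⟩ := exists_le_likelihood hσh hσf
  set K := (√(2 * Real.pi * S.σf2))⁻¹ with hK
  have hKpos : 0 < K := by positivity
  -- The constant K bounds the numerator and is a factor of the lower bound for the denominator, so
  -- it cancels. Oddness then turns this upper bound into the lower one.
  have key : ∀ v, S.reliability v ≤ v ^ 2 / S.σf2 + |Real.log q| := by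
    intro v
    rw [reliability, Real.log_div (likelihood_pos hσh hσf _ _).ne'
      (likelihood_pos hσh hσf _ _).ne', likelihood_true]
    have h1 := Real.log_le_log (likelihood_pos hσh hσf _ _) (likelihood_le hσh false v)
    have h2 := Real.log_le_log (by positivity) (hle (-v))
    rw [Real.log_mul hKpos.ne' (by positivity), Real.log_mul hq.ne' (Real.exp_pos _).ne',
      Real.log_exp, neg_sq] at h2
    have := neg_abs_le (Real.log q)
    linarith
  refine ⟨|Real.log q|, abs_nonneg _, fun v => abs_le.2 ⟨?_, key v⟩⟩
  have := key (-v)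
  rw [reliability_neg, neg_sq] at this
  linarith

lemma gaussianPDFReal_neg_lt {m v : ℝ} {s : ℝ≥0} (hs : 0 < s) (hm : 0 < m) (hv : 0 < v) :
    gaussianPDFReal (-m) s v < gaussianPDFReal m s v := by
  have hs' : (0 : ℝ) < s := by exact_mod_cast hs
  simp only [gaussianPDFReal]
  refine mul_lt_mul_of_pos_left (Real.exp_lt_exp.2 ?_) (by positivity)
  rw [div_lt_div_iff_of_pos_right (by positivity)]
  nlinarith [mul_pos hm hv]

/-- The fading coefficient is almost surely positive, so a positive output is closer to the mean for
bit 0 whatever the fading; averaging keeps the inequality strict. -/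
lemma reliability_pos (hEb : 0 < S.Eb) (hσh : 0 < S.σh2) (hσf : 0 < S.σf2) {v : ℝ} (hv : 0 < v) :
    0 < S.reliability v := by
  have hP := isProbabilityMeasure_rayleigh hσh
  refine Real.log_pos ?_
  rw [one_lt_div (likelihood_pos hσh hσf _ _)]
  refine lt_of_sub_pos ?_
  unfold likelihood
  have hi := fun u => integrable_likelihood hσh u v
  rw [← integral_sub (hi _) (hi _)]
  have hpos : ∀ᵐ h ∂(rayleigh S.σh2), 0 < gaussianPDFReal (h * antipodal false * √S.Eb) S.σf2 v
      - gaussianPDFReal (h * antipodal true * √S.Eb) S.σf2 v := by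
    filter_upwards [rayleigh_ae_pos S.σh2] with h hh
    have := gaussianPDFReal_neg_lt (m := h * √S.Eb) hσf (by positivity) hv
    simp only [antipodal, Bool.false_eq_true, if_false, if_true, mul_one, mul_neg, neg_mul]
    linarith
  rw [integral_pos_iff_support_of_nonneg_ae (hpos.mono fun h hh => hh.le) ((hi _).sub (hi _))]
  rw [pos_iff_ne_zero]
  intro h0
  have : ∀ᵐ h ∂(rayleigh S.σh2), False := by
    filter_upwards [hpos, measure_eq_zero_iff_ae_notMem.1 h0] with h h1 h2
    exact h2 (by simpa [Function.mem_support] using h1.ne')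
  exact this.exists.choose_spec

/-! ### The mean reliability -/

lemma memLp_sq_gaussianReal (m : ℝ) (s : ℝ≥0) :
    MemLp (fun x : ℝ => x ^ 2) 2 (gaussianReal m s) := by
  rw [memLp_two_iff_integrable_sq (by fun_prop)]
  have := (memLp_id_gaussianReal (μ := m) (v := s) 4).integrable_norm_pow (by norm_num)
  refine this.congr (ae_of_all _ fun x => ?_)
  simp only [id, Real.norm_eq_abs]
  rw [← pow_mul, Even.pow_abs (by decide)]

lemma integrable_reliability_gaussianReal (hσh : 0 < S.σh2) (hσf : 0 < S.σf2) (m : ℝ) :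
    Integrable S.reliability (gaussianReal m S.σf2) := by
  obtain ⟨C, -, hC⟩ := exists_abs_reliability_le hσh hσf
  have h2 := (memLp_sq_gaussianReal m S.σf2).integrable (by norm_num)
  exact ((h2.div_const _).add (integrable_const C)).mono'
    (measurable_reliability hσh).aestronglyMeasurable (ae_of_all _ hC)

lemma integral_reliability_gaussianReal_neg (hσh : 0 < S.σh2) (m : ℝ) :
    ∫ v, S.reliability v ∂(gaussianReal (-m) S.σf2)
      = -∫ v, S.reliability v ∂(gaussianReal m S.σf2) := by
  rw [← gaussianReal_map_neg, integral_map (by fun_prop)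
    (measurable_reliability hσh).aestronglyMeasurable, ← integral_neg]
  simp_rw [reliability_neg]

/-- By oddness, twice this mean is the difference of the means at `m` and `-m`. There the difference
of densities and the reliability are both odd and have the sign of v, so the integrand is positive
off 0. -/
lemma integral_reliability_gaussianReal_pos (hEb : 0 < S.Eb) (hσh : 0 < S.σh2) (hσf : 0 < S.σf2)
    {m : ℝ} (hm : 0 < m) : 0 < ∫ v, S.reliability v ∂(gaussianReal m S.σf2) := by
  have hi := fun m => integrable_reliability_gaussianReal (S := S) hσh hσf m
  have hneg := integral_reliability_gaussianReal_neg (S := S) hσh m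
  suffices h : 0 < ∫ v, S.reliability v ∂(gaussianReal m S.σf2)
      - ∫ v, S.reliability v ∂(gaussianReal (-m) S.σf2) by linarith
  have hi' : ∀ m, Integrable (fun v => gaussianPDFReal m S.σf2 v • S.reliability v) := by
    intro m
    have := hi m
    rw [gaussianReal_of_var_ne_zero _ hσf.ne', integrable_withDensity_iff_integrable_smul'
      (measurable_gaussianPDF _ _) (by simp [gaussianPDF])] at this
    simpa only [toReal_gaussianPDF] using this
  rw [integral_gaussianReal_eq_integral_smul hσf.ne', integral_gaussianReal_eq_integral_smul hσf.ne',
    ← integral_sub (hi' _) (hi' _)]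
  have hpos : ∀ v, v ≠ 0 → 0 < gaussianPDFReal m S.σf2 v • S.reliability v
      - gaussianPDFReal (-m) S.σf2 v • S.reliability v := by
    have hflip : ∀ v, gaussianPDFReal m S.σf2 (-v) = gaussianPDFReal (-m) S.σf2 v := by
      intro v
      simp only [gaussianPDFReal]
      ring_nf
    have key : ∀ v, 0 < v → 0 < gaussianPDFReal m S.σf2 v • S.reliability v
        - gaussianPDFReal (-m) S.σf2 v • S.reliability v := by
      intro v hv
      rw [smul_eq_mul, smul_eq_mul, ← sub_mul]
      exact mul_pos (sub_pos.2 (gaussianPDFReal_neg_lt hσf hm hv)) (reliability_pos hEb hσh hσf hv)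
    intro v hv
    rcases lt_or_gt_of_ne hv with h | h
    · have h1 := key (-v) (neg_pos.2 h)
      have h2 := hflip (-v)
      rw [neg_neg] at h2
      rw [hflip, ← h2, reliability_neg, smul_neg, smul_neg] at h1
      linarith
    · exact key v h
  refine (integral_pos_iff_support_of_nonneg ?_ ((hi' m).sub (hi' (-m)))).2 ?_
  rotate_left
  · refine lt_of_lt_of_le ?_ (measure_mono (s := Set.Ioi (0 : ℝ)) fun v hv => ?_)
    · simp
    · exact (hpos v (ne_of_gt hv)).ne'
  · intro v
    rcases eq_or_ne v 0 with rfl | hv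
    · have : S.reliability 0 = 0 := by
        have := reliability_neg (S := S) 0
        rw [neg_zero] at this
        linarith
      simp [this]
    · exact (hpos v hv).le

/-- The channel output when the bit `u` is sent, with fading coefficient `p.1` and channel noise
`p.2`. -/
noncomputable def channelOutput (S : Model) (u : Bool) (p : ℝ × ℝ) : ℝ := p.1 * antipodal u * √S.Eb + p.2

/-- The mean reliability of the channel output when the bit `0` is sent. -/
noncomputable def meanReliability (S : Model) : ℝ :=
  ∫ p, S.reliability (S.channelOutput false p) ∂((rayleigh S.σh2).prod (gaussianReal 0 S.σf2))

/-- A square integrable bound, uniform in the sent bit, for the reliability. -/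
lemma exists_reliability_bound (hσh : 0 < S.σh2) (hσf : 0 < S.σf2) :
    ∃ G : ℝ × ℝ → ℝ, MemLp G 2 ((rayleigh S.σh2).prod (gaussianReal 0 S.σf2)) ∧
      ∀ u p, |S.reliability (S.channelOutput u p)| ≤ G p := by
  have := isProbabilityMeasure_rayleigh hσh
  obtain ⟨C, -, hC⟩ := exists_abs_reliability_le hσh hσf
  refine ⟨fun p => (2 / S.σf2 * √S.Eb ^ 2) * p.1 ^ 2 + (2 / S.σf2 * p.2 ^ 2 + C), ?_, ?_⟩
  · exact (((memLp_sq_rayleigh hσh).comp_fst _).const_mul _).add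
      ((((memLp_sq_gaussianReal 0 S.σf2).comp_snd _).const_mul _).add (memLp_const C))
  · intro u p
    refine (hC _).trans ?_
    have hs : (0 : ℝ) < S.σf2 := by exact_mod_cast hσf
    have hu : antipodal u ^ 2 = 1 := by cases u <;> simp [antipodal]
    have : S.channelOutput u p ^ 2 ≤ 2 * (√S.Eb ^ 2 * p.1 ^ 2 + p.2 ^ 2) := by
      have h1 : (p.1 * antipodal u * √S.Eb) ^ 2 = √S.Eb ^ 2 * p.1 ^ 2 := by
        rw [mul_pow, mul_pow, hu]; ring
      rw [channelOutput, ← h1]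
      nlinarith [sq_nonneg (p.1 * antipodal u * √S.Eb - p.2)]
    calc S.channelOutput u p ^ 2 / S.σf2 + C
        ≤ 2 * (√S.Eb ^ 2 * p.1 ^ 2 + p.2 ^ 2) / S.σf2 + C := by gcongr
      _ = _ := by ring

lemma measurable_channelOutput (u : Bool) : Measurable (S.channelOutput u) := by
  unfold channelOutput
  fun_prop

lemma integrable_reliability_channelOutput (hσh : 0 < S.σh2) (hσf : 0 < S.σf2) (u : Bool) :
    Integrable (fun p => S.reliability (S.channelOutput u p))
      ((rayleigh S.σh2).prod (gaussianReal 0 S.σf2)) := by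
  have := isProbabilityMeasure_rayleigh hσh
  obtain ⟨G, hG, hle⟩ := exists_reliability_bound hσh hσf
  exact (hG.integrable (by norm_num)).mono' (((measurable_reliability hσh).comp
    (measurable_channelOutput u)).aestronglyMeasurable) (ae_of_all _ (hle u))

/-- Given the fading, the output is Gaussian with a shifted mean, which reduces the sign questions
to the Gaussian case. -/
lemma integral_reliability_channelOutput (hσh : 0 < S.σh2) (hσf : 0 < S.σf2) (u : Bool) :
    ∫ p, S.reliability (S.channelOutput u p) ∂((rayleigh S.σh2).prod (gaussianReal 0 S.σf2))
      = ∫ h, ∫ v, S.reliability v ∂(gaussianReal (h * antipodal u * √S.Eb) S.σf2)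
        ∂(rayleigh S.σh2) := by
  have := isProbabilityMeasure_rayleigh hσh
  rw [integral_prod _ (integrable_reliability_channelOutput hσh hσf u)]
  congr 1
  ext h
  have := gaussianReal_map_const_add (μ := 0) (v := S.σf2) (h * antipodal u * √S.Eb)
  rw [zero_add] at this
  rw [← this, integral_map (by fun_prop) (measurable_reliability hσh).aestronglyMeasurable]
  rfl

lemma integral_reliability_channelOutput_eq (hσh : 0 < S.σh2) (hσf : 0 < S.σf2) (u : Bool) :
    ∫ p, S.reliability (S.channelOutput u p) ∂((rayleigh S.σh2).prod (gaussianReal 0 S.σf2))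
      = antipodal u * S.meanReliability := by
  cases u
  · simp [antipodal, meanReliability]
  · rw [meanReliability, integral_reliability_channelOutput hσh hσf,
      integral_reliability_channelOutput hσh hσf, ← integral_const_mul]
    congr 1
    ext h
    simp only [antipodal, Bool.false_eq_true, if_false, if_true, mul_one, mul_neg, neg_mul, one_mul]
    exact integral_reliability_gaussianReal_neg hσh _

lemma meanReliability_pos (hEb : 0 < S.Eb) (hσh : 0 < S.σh2) (hσf : 0 < S.σf2) :
    0 < S.meanReliability := by
  have := isProbabilityMeasure_rayleigh hσh
  have hint : Integrable (fun h => ∫ v, S.reliability v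
      ∂(gaussianReal (h * antipodal false * √S.Eb) S.σf2)) (rayleigh S.σh2) := by
    refine (integrable_reliability_channelOutput hσh hσf false).integral_prod_left.congr
      (ae_of_all _ fun h => ?_)
    have := gaussianReal_map_const_add (μ := 0) (v := S.σf2) (h * antipodal false * √S.Eb)
    rw [zero_add] at this
    simp only
    rw [← this, integral_map (by fun_prop) (measurable_reliability hσh).aestronglyMeasurable]
    rfl
  rw [meanReliability, integral_reliability_channelOutput hσh hσf]
  have hpos : ∀ᵐ h ∂(rayleigh S.σh2), 0 < ∫ v, S.reliability v
      ∂(gaussianReal (h * antipodal false * √S.Eb) S.σf2) := by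
    filter_upwards [rayleigh_ae_pos S.σh2] with h hh
    exact integral_reliability_gaussianReal_pos hEb hσh hσf
      (by simp only [antipodal, Bool.false_eq_true, if_false]; positivity)
  rw [integral_pos_iff_support_of_nonneg_ae (hpos.mono fun h hh => hh.le) hint, pos_iff_ne_zero]
  intro h0
  have : ∀ᵐ h ∂(rayleigh S.σh2), False := by
    filter_upwards [hpos, measure_eq_zero_iff_ae_notMem.1 h0] with h h1 h2
    exact h2 (by simpa [Function.mem_support] using h1.ne')
  exact this.exists.choose_spec

/-! ### The reliability of a sensor -/

/-- The reliability of a sensor with amplitude `a` and threshold `η`. -/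
noncomputable def sensorReliability (S : Model) (a η : ℝ) (ω : Sample) : ℝ :=
  S.reliability (S.received a η ω)

lemma sensorReliability_mk (a η w : ℝ) (b : Bool) (p : ℝ × ℝ) :
    S.sensorReliability a η (w, b, p)
      = S.reliability (S.channelOutput (xor (decide (η < a + w)) b) p) := rfl

lemma isProbabilityMeasure_sampleLaw (hα₀ : 0 ≤ S.α) (hα : S.α ≤ 1) (hσh : 0 < S.σh2)
    (hnoise : IsProbabilityMeasure S.noise) : IsProbabilityMeasure S.sampleLaw := by
  have := isProbabilityMeasure_rayleigh hσh
  have := isProbabilityMeasure_coin hα₀ hα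
  unfold sampleLaw
  infer_instance

lemma measurable_sentBit (η : ℝ) : Measurable fun p : ℝ × Sample => sentBit p.1 η p.2 := by
  have h1 : Measurable fun p : ℝ × Sample => decide (η < p.1 + p.2.1) := by
    have : Measurable fun p : ℝ × Sample => if η < p.1 + p.2.1 then true else false :=
      Measurable.ite (measurableSet_lt measurable_const (by fun_prop))
        measurable_const measurable_const
    simpa using this
  have h2 : Measurable fun p : ℝ × Sample => p.2.2.1 := by fun_prop
  have h3 : Measurable fun q : Bool × Bool => xor q.1 q.2 := .of_discrete
  exact h3.comp (h1.prodMk h2)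

lemma measurable_sensorReliability (hσh : 0 < S.σh2) (η : ℝ) :
    Measurable fun p : ℝ × Sample => S.sensorReliability p.1 η p.2 := by
  have h1 : Measurable fun p : ℝ × Sample => antipodal (sentBit p.1 η p.2) :=
    (Measurable.of_discrete (f := antipodal)).comp (measurable_sentBit η)
  have h2 : Measurable fun p : ℝ × Sample => p.2.2.2.1 := by fun_prop
  have h3 : Measurable fun p : ℝ × Sample => p.2.2.2.2 := by fun_prop
  have h4 : Measurable fun p : ℝ × Sample => S.received p.1 η p.2 :=
    ((h2.mul h1).mul_const _).add h3
  exact (measurable_reliability hσh).comp h4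

lemma measurable_sensorReliability_right (hσh : 0 < S.σh2) (a η : ℝ) :
    Measurable (S.sensorReliability a η) := by
  have h : Measurable fun ω : Sample => (a, ω) := measurable_const.prodMk measurable_id
  have h' := (measurable_sensorReliability hσh η).comp h
  simp only [Function.comp_def] at h'
  exact h'

/-- The reliabilities of all sensors are square integrable, with a common bound. -/
lemma exists_sensorReliability_bound (hα₀ : 0 ≤ S.α) (hα : S.α ≤ 1) (hσh : 0 < S.σh2)
    (hσf : 0 < S.σf2) (hnoise : IsProbabilityMeasure S.noise) :
    ∃ G : Sample → ℝ, MemLp G 2 S.sampleLaw ∧ ∀ a η ω, |S.sensorReliability a η ω| ≤ G ω := by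
  have := isProbabilityMeasure_rayleigh hσh
  have := isProbabilityMeasure_coin hα₀ hα
  obtain ⟨G, hG, hle⟩ := exists_reliability_bound hσh hσf
  have h1 : MemLp (fun q : Bool × ℝ × ℝ => G q.2) 2
      ((coin S.α).prod ((rayleigh S.σh2).prod (gaussianReal 0 S.σf2))) := hG.comp_snd _
  have h2 : MemLp (fun ω : Sample => G ω.2.2) 2 S.sampleLaw := h1.comp_snd S.noise
  exact ⟨fun ω => G ω.2.2, h2, fun a η ω => hle (sentBit a η ω) ω.2.2⟩

lemma memLp_sensorReliability (hα₀ : 0 ≤ S.α) (hα : S.α ≤ 1) (hσh : 0 < S.σh2)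
    (hσf : 0 < S.σf2) (hnoise : IsProbabilityMeasure S.noise) (a η : ℝ) :
    MemLp (S.sensorReliability a η) 2 S.sampleLaw := by
  obtain ⟨G, hG, hle⟩ := exists_sensorReliability_bound hα₀ hα hσh hσf hnoise
  exact hG.of_le (measurable_sensorReliability_right hσh a η).aestronglyMeasurable
    (ae_of_all _ fun ω => (hle a η ω).trans (le_abs_self _))

/-- Amplitude and threshold act only through the sent bit, so unbounded amplitudes near the target
do not spoil the uniform bound. -/
lemma exists_variance_sensorReliability_le (hα₀ : 0 ≤ S.α) (hα : S.α ≤ 1) (hσh : 0 < S.σh2)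
    (hσf : 0 < S.σf2) (hnoise : IsProbabilityMeasure S.noise) :
    ∃ V : ℝ, ∀ a η, Var[S.sensorReliability a η; S.sampleLaw] ≤ V := by
  have := isProbabilityMeasure_sampleLaw hα₀ hα hσh hnoise
  obtain ⟨G, hG, hle⟩ := exists_sensorReliability_bound hα₀ hα hσh hσf hnoise
  refine ⟨∫ ω, G ω ^ 2 ∂S.sampleLaw, fun a η => ?_⟩
  refine (variance_le_expectation_sq
    (measurable_sensorReliability_right hσh a η).aestronglyMeasurable).trans ?_
  refine integral_mono (memLp_sensorReliability hα₀ hα hσh hσf hnoise a η).integrable_sq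
    hG.integrable_sq fun ω => ?_
  simp only [Pi.pow_apply]
  exact sq_le_sq.2 ((hle a η ω).trans (le_abs_self _))

/-- The mean reliability of a sensor, in terms of the complementary distribution function of the
sensor noise. -/
lemma integral_sensorReliability (hα₀ : 0 ≤ S.α) (hα : S.α ≤ 1) (hσh : 0 < S.σh2)
    (hσf : 0 < S.σf2) (hnoise : IsProbabilityMeasure S.noise) (a η : ℝ) :
    ∫ ω, S.sensorReliability a η ω ∂S.sampleLaw
      = S.meanReliability * (1 - 2 * S.α) * (1 - 2 * S.noise.real (Set.Ioi (η - a))) := by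
  have := isProbabilityMeasure_sampleLaw hα₀ hα hσh hnoise
  have := isProbabilityMeasure_rayleigh hσh
  have := isProbabilityMeasure_coin hα₀ hα
  have hint := (memLp_sensorReliability hα₀ hα hσh hσf hnoise a η).integrable (by norm_num)
  rw [sampleLaw] at hint ⊢
  rw [integral_prod _ hint]
  have hinner : ∀ᵐ w ∂S.noise, (∫ q, S.sensorReliability a η (w, q)
      ∂((coin S.α).prod ((rayleigh S.σh2).prod (gaussianReal 0 S.σf2))))
      = S.meanReliability * (1 - 2 * S.α) *
        (1 - 2 * (Set.Ioi (η - a)).indicator (fun _ => (1 : ℝ)) w) := by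
    filter_upwards [hint.prod_right_ae] with w hw
    rw [integral_prod _ hw]
    have hb : ∀ b, ∫ y, S.sensorReliability a η (w, b, y)
        ∂((rayleigh S.σh2).prod (gaussianReal 0 S.σf2))
        = antipodal (xor (decide (η < a + w)) b) * S.meanReliability := by
      intro b
      simp only [sensorReliability_mk]
      rw [integral_reliability_channelOutput_eq hσh hσf]
    -- Averaging over the Byzantine coin gives the factor (1 - α) - α; the remaining sign says
    -- whether the threshold is crossed.
    simp_rw [hb]
    rw [integral_coin hα₀ hα]
    by_cases h : η < a + w
    · have : w ∈ Set.Ioi (η - a) := by simp only [Set.mem_Ioi]; linarith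
      simp only [h, this, antipodal, Set.indicator_of_mem, decide_true, Bool.xor_true,
        Bool.not_true, Bool.xor_false, if_true, Bool.false_eq_true, if_false]
      ring
    · have : w ∉ Set.Ioi (η - a) := by simp only [Set.mem_Ioi]; linarith
      simp only [h, this, antipodal, Set.indicator_of_notMem, decide_false, Bool.xor_true,
        Bool.not_false, Bool.xor_false, if_true, Bool.false_eq_true, if_false,
        not_false_eq_true]
      ring
  rw [integral_congr_ae hinner, integral_const_mul, integral_sub (integrable_const _)
    ((integrable_const (1 : ℝ)).indicator measurableSet_Ioi |>.const_mul 2), integral_const_mul,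
    integral_indicator_const _ measurableSet_Ioi]
  simp

end Model

/-! ### Geometry of the regions -/

namespace Splitting

variable {M : ℕ} (Z : Splitting M)

lemma isOpen_nearest (k : ℕ) (j : Fin M) :
    IsOpen {x : Plane | ∀ l, l ≠ j → dist x (Z.center k j) < dist x (Z.center k l)} := by
  simp only [Set.ofPred_forall]
  exact isOpen_iInter_of_finite fun l => isOpen_iInter_of_finite fun _ =>
    isOpen_lt (by fun_prop) (by fun_prop)

lemma exists_isOpen_roi_eq (k : ℕ) : ∃ U, IsOpen U ∧ Z.roi k = Z.roi₀ ∩ U := by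
  induction k with
  | zero => exact ⟨Set.univ, isOpen_univ, (Set.inter_univ _).symm⟩
  | succ k ih =>
    obtain ⟨U, hU, h⟩ := ih
    refine ⟨_, hU.inter (Z.isOpen_nearest k (Z.path k)), ?_⟩
    rw [← Set.inter_assoc, ← h]
    rfl

lemma exists_isOpen_region_eq (k : ℕ) (j : Fin M) :
    ∃ U, IsOpen U ∧ Z.region k j = Z.roi₀ ∩ U := by
  obtain ⟨U, hU, h⟩ := Z.exists_isOpen_roi_eq k
  refine ⟨_, hU.inter (Z.isOpen_nearest k j), ?_⟩
  rw [← Set.inter_assoc, ← h]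
  rfl

lemma measurableSet_region (h : MeasurableSet Z.roi₀) (k : ℕ) (j : Fin M) :
    MeasurableSet (Z.region k j) := by
  obtain ⟨U, hU, h'⟩ := Z.exists_isOpen_region_eq k j
  exact h' ▸ h.inter hU.measurableSet

lemma region_subset_roi₀ (k : ℕ) (j : Fin M) : Z.region k j ⊆ Z.roi₀ := by
  obtain ⟨U, -, h⟩ := Z.exists_isOpen_region_eq k j
  exact h ▸ Set.inter_subset_left

lemma region_subset_roi (k : ℕ) (j : Fin M) : Z.region k j ⊆ Z.roi k := fun _ h => h.1

/-- Regions are only relatively open, as the initial region is an arbitrary measurable set. This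
suffices because all sensors lie in it. -/
lemma exists_ball_subset_region {k : ℕ} {j : Fin M} {θ : Plane} (h : θ ∈ Z.region k j) :
    ∃ r > 0, ∀ x ∈ Z.roi₀, dist x θ < r → x ∈ Z.region k j := by
  obtain ⟨U, hU, h'⟩ := Z.exists_isOpen_region_eq k j
  rw [h'] at h ⊢
  obtain ⟨r, hr, hsub⟩ := Metric.isOpen_iff.1 hU θ h.2
  exact ⟨r, hr, fun x hx hd => ⟨hx, hsub hd⟩⟩

lemma eq_of_mem_region {k : ℕ} {j l : Fin M} {x : Plane} (hj : x ∈ Z.region k j)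
    (hl : x ∈ Z.region k l) : j = l := by
  by_contra hne
  exact lt_asymm (hj.2 l (Ne.symm hne)) (hl.2 j hne)

lemma threshold_of_mem_region (P₀ : ℝ) {k : ℕ} {j : Fin M} {x : Plane} (h : x ∈ Z.region k j) :
    Z.threshold P₀ k x = √P₀ / dist x (Z.center k j) := by
  have : Nonempty (Fin M) := ⟨j⟩
  rw [threshold]
  congr 1
  refine le_antisymm (ciInf_le (Set.finite_range _).bddBelow j) (le_ciInf fun l => ?_)
  rcases eq_or_ne l j with rfl | hl
  · rfl
  · exact (h.2 l hl).le

lemma mem_sensors {N : ℕ} {L : Fin N → Plane} {k : ℕ} {j : Fin M} {i : Fin N} :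
    i ∈ Z.sensors L k j ↔ L i ∈ Z.region k j := by
  simp [sensors]

/-- If the regions of iteration `0` contain `N / M` sensors each, then there are no further
sensors. -/
lemma mem_roi₀_of_card_sensors {N : ℕ} {L : Fin N → Plane}
    (hcard : ∀ j : Fin M, (Z.sensors L 0 j).card * M ^ (0 + 1) = N) (i : Fin N) :
    L i ∈ Z.roi₀ := by
  classical
  have hM : 0 < M := (Nat.zero_le _).trans_lt (Z.path 0).2
  have hdisj : Set.PairwiseDisjoint (Finset.univ : Finset (Fin M)) (Z.sensors L 0) := by
    intro j _ l _ hne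
    rw [Function.onFun, Finset.disjoint_left]
    exact fun i hi hi' => hne (Z.eq_of_mem_region (Z.mem_sensors.1 hi) (Z.mem_sensors.1 hi'))
  have hunion : (Finset.univ.biUnion (Z.sensors L 0)).card = N := by
    rw [Finset.card_biUnion hdisj]
    refine Nat.eq_of_mul_eq_mul_right hM ?_
    rw [Finset.sum_mul]
    simp only [zero_add, pow_one] at hcard
    simp [hcard, mul_comm]
  have huniv := (Finset.card_eq_iff_eq_univ _).1 (hunion.trans (Fintype.card_fin N).symm)
  have hi : i ∈ Finset.univ.biUnion (Z.sensors L 0) := huniv ▸ Finset.mem_univ i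
  obtain ⟨j, -, hj⟩ := Finset.mem_biUnion.1 hi
  exact Z.region_subset_roi₀ 0 j (Z.mem_sensors.1 hj)

end Splitting

/-! ### The decoder -/

section Decoder

variable {M N : ℕ} (Z : Splitting M) (L : Fin N → Plane) (k : ℕ)

/-- Up to a term common to all hypotheses, the `F`-distance to hypothesis `j` is a multiple of the
sum of the reliabilities of the sensors of region `j`. -/
lemma fDist_eq (ψ : Fin N → ℝ) (j : Fin M) :
    fDist Z L k ψ j
      = ∑ i ∈ Z.activeSensors L k, (ψ i - 1) ^ 2 + 4 * ∑ i ∈ Z.sensors L k j, ψ i := by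
  classical
  have hsub : Z.sensors L k j = (Z.activeSensors L k).filter fun i => L i ∈ Z.region k j := by
    ext i
    simp only [Splitting.mem_sensors, Splitting.activeSensors, Finset.mem_filter, Finset.mem_univ,
      true_and]
    exact ⟨fun h => ⟨Z.region_subset_roi k j h, h⟩, fun h => h.2⟩
  rw [hsub, Finset.sum_filter, Finset.mul_sum, ← Finset.sum_add_distrib, fDist]
  refine Finset.sum_congr rfl fun i _ => ?_
  by_cases h : L i ∈ Z.region k j
  · simp only [Splitting.code, antipodal, h, decide_true, if_true]
    ring
  · simp only [Splitting.code, antipodal, h, decide_false, if_false, Bool.false_eq_true]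
    ring

lemma mem_minimizers {ψ : Fin N → ℝ} {j : Fin M} :
    j ∈ minimizers Z L k ψ ↔
      ∀ l, ∑ i ∈ Z.sensors L k j, ψ i ≤ ∑ i ∈ Z.sensors L k l, ψ i := by
  simp [minimizers, fDist_eq]

lemma reward_eq_one {ψ : Fin N → ℝ} {j : Fin M}
    (h : ∀ l ≠ j, ∑ i ∈ Z.sensors L k j, ψ i < ∑ i ∈ Z.sensors L k l, ψ i) :
    reward Z L k j ψ = 1 := by
  have : minimizers Z L k ψ = {j} := by
    ext l
    rw [mem_minimizers, Finset.mem_singleton]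
    constructor
    · intro hl
      by_contra hne
      exact (h l hne).not_ge (hl j)
    · rintro rfl l'
      rcases eq_or_ne l' l with rfl | hne
      · rfl
      · exact (h l' hne).le
  simp [reward, this]

lemma reward_nonneg (j : Fin M) (ψ : Fin N → ℝ) : 0 ≤ reward Z L k j ψ := by
  unfold reward
  split_ifs <;> positivity

lemma reward_le_one (j : Fin M) (ψ : Fin N → ℝ) : reward Z L k j ψ ≤ 1 := by
  unfold reward
  split_ifs with h
  · have : (1 : ℝ) ≤ (minimizers Z L k ψ).card := by
      exact_mod_cast Finset.card_pos.2 ⟨j, h⟩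
    exact div_le_one_of_le₀ this (by positivity)
  · exact zero_le_one

lemma measurable_reward (j : Fin M) : Measurable (reward Z L k j) := by
  classical
  have hset : ∀ j, MeasurableSet {ψ : Fin N → ℝ | j ∈ minimizers Z L k ψ} := by
    intro j
    simp only [mem_minimizers, Set.ofPred_forall]
    exact MeasurableSet.iInter fun l => measurableSet_le (by fun_prop) (by fun_prop)
  have hcard : Measurable fun ψ : Fin N → ℝ => ((minimizers Z L k ψ).card : ℝ) := by
    have : (fun ψ : Fin N → ℝ => ((minimizers Z L k ψ).card : ℝ))
        -- As a sum of indicators, the number of minimizers is visibly measurable.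
        = fun ψ => ∑ l, if l ∈ minimizers Z L k ψ then (1 : ℝ) else 0 := by
      ext ψ
      simp
    rw [this]
    exact Finset.measurable_fun_sum _ fun l _ =>
      Measurable.ite (hset l) measurable_const measurable_const
  unfold reward
  exact Measurable.ite (hset j) (measurable_const.div hcard) measurable_const

end Decoder

/-! ### Chebyshev's inequality for signed sums -/

/-- A signed sum of independent random variables with bounded variances is positive with high
probability, if its mean is large. -/
lemma measureReal_sum_nonpos_le {Ω : Type*} [MeasurableSpace Ω] {μ : Measure Ω}
    [IsProbabilityMeasure μ] {n : ℕ} {X : Fin n → Ω → ℝ} (hX : ∀ i, MemLp (X i) 2 μ) {V : ℝ}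
    (hV : ∀ i, Var[X i; μ] ≤ V) {c : Fin n → ℝ} (hc : ∀ i, c i ^ 2 ≤ 1) {t : ℝ} (ht : 0 < t)
    (hmean : t ≤ ∑ i, c i * ∫ ω, X i ω ∂μ) :
    (Measure.pi fun _ : Fin n => μ).real {ω | ∑ i, c i * X i (ω i) ≤ 0} ≤ n * V / t ^ 2 := by
  have hY : ∀ i, MemLp (fun ω => c i * X i ω) 2 μ := fun i => (hX i).const_mul _
  have hYpi : ∀ i, MemLp (fun ω : Fin n → Ω => c i * X i (ω i)) 2 (Measure.pi fun _ => μ) :=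
    fun i => (hY i).comp_measurePreserving (measurePreserving_eval (fun _ : Fin n => μ) i)
  set Y : (Fin n → Ω) → ℝ := ∑ i, fun ω => c i * X i (ω i) with hYdef
  have hYmem : MemLp Y 2 (Measure.pi fun _ : Fin n => μ) := memLp_finsetSum' _ fun i _ => hYpi i
  have hYapp : ∀ ω, Y ω = ∑ i, c i * X i (ω i) := fun ω => by simp [hYdef]
  have hEY : ∫ ω, Y ω ∂(Measure.pi fun _ : Fin n => μ) = ∑ i, c i * ∫ ω, X i ω ∂μ := by
    simp_rw [hYapp]
    rw [integral_finsetSum _ fun i _ => (hYpi i).integrable (by norm_num)]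
    refine Finset.sum_congr rfl fun i _ => ?_
    rw [← integral_const_mul]
    exact integral_comp_eval (μ := fun _ : Fin n => μ) (f := fun ω => c i * X i ω)
      (hY i).aestronglyMeasurable
  have hVY : Var[Y; Measure.pi fun _ : Fin n => μ] ≤ n * V := by
    rw [hYdef, variance_sum_pi hY]
    calc ∑ i, Var[fun ω => c i * X i ω; μ] ≤ ∑ _i : Fin n, V := by
          refine Finset.sum_le_sum fun i _ => ?_
          rw [variance_const_mul]
          exact (mul_le_of_le_one_left (variance_nonneg _ _) (hc i)).trans (hV i)
      _ = n * V := by simp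
  have hcheb := meas_ge_le_variance_div_sq hYmem ht
  calc (Measure.pi fun _ : Fin n => μ).real {ω | ∑ i, c i * X i (ω i) ≤ 0}
      ≤ (Measure.pi fun _ : Fin n => μ).real
          {ω | t ≤ |Y ω - ∫ ω, Y ω ∂(Measure.pi fun _ : Fin n => μ)|} := by
        -- A sum that is at most 0 misses its mean, which is at least `t`, by at least `t`.
        refine measureReal_mono fun ω hω => ?_
        simp only [Set.mem_ofPred_eq] at hω ⊢
        rw [hYapp, hEY, abs_sub_comm]
        exact le_trans (by linarith) (le_abs_self _)
    _ ≤ Var[Y; Measure.pi fun _ : Fin n => μ] / t ^ 2 := by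
        refine (ENNReal.toReal_mono ENNReal.ofReal_ne_top hcheb).trans_eq ?_
        exact ENNReal.toReal_ofReal (div_nonneg (variance_nonneg _ _) (sq_nonneg _))
    _ ≤ n * V / t ^ 2 := by gcongr

/-! ### The gap between the detection rates of near and far sensors -/

/-- Near the target the amplitude exceeds that at a distance by so much that the probabilities of
crossing the threshold differ by a constant. -/
lemma exists_tail_gap {F : ℝ → ℝ} (hF : StrictAnti F) {P₀ : ℝ} (hP₀ : 0 < P₀) (θ c : Plane)
    {r : ℝ} (hr : 0 < r) :
    ∃ δ > 0, ∃ ε > 0, ε ≤ r ∧ ∀ x y : Plane, x ≠ θ → dist x θ < ε → r ≤ dist y θ →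
      δ ≤ F (√P₀ / dist x c - amplitude P₀ θ x) - F (√P₀ / dist x c - amplitude P₀ θ y) := by
  have hs : 0 < √P₀ := Real.sqrt_pos.2 hP₀
  set T := √P₀ / r with hT
  have hTpos : 0 < T := by positivity
  have hay : ∀ y : Plane, r ≤ dist y θ → amplitude P₀ θ y ≤ T := by
    intro y hy
    rw [amplitude, dist_comm, hT]
    gcongr
  have hax : ∀ B > 0, ∀ x : Plane, x ≠ θ → dist x θ < √P₀ / B → B ≤ amplitude P₀ θ x := by
    intro B hB x hx hd
    have hpos := dist_pos.2 hx
    rw [amplitude, dist_comm, le_div_iff₀ hpos]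
    rw [lt_div_iff₀ hB] at hd
    linarith
  -- If the target is at the center, the threshold blows up near it but equals the amplitude at `x`,
  -- so the arguments of F are 0 and at least 1. Otherwise the threshold stays below a constant A
  -- near the target, and amplitude A + T + 1 puts the arguments below -T - 1 and above -T.
  rcases eq_or_ne θ c with rfl | hne
  · refine ⟨F 0 - F 1, sub_pos.2 (hF one_pos), min r (√P₀ / (T + 1)), by positivity,
      min_le_left _ _, fun x y hx hd hy => ?_⟩
    have h1 := hax (T + 1) (by positivity) x hx (hd.trans_le (min_le_right _ _))
    have h2 := hay y hy
    have h3 : √P₀ / dist x θ = amplitude P₀ θ x := by rw [amplitude, dist_comm]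
    rw [h3, sub_self]
    exact sub_le_sub_left (hF.antitone (by linarith)) _
  · have hD : 0 < dist θ c := dist_pos.2 hne
    set A := √P₀ / (dist θ c / 2) with hA
    have hApos : 0 < A := by positivity
    refine ⟨F (-T - 1) - F (-T), sub_pos.2 (hF (by linarith)),
      min r (min (dist θ c / 2) (√P₀ / (A + T + 1))), by positivity,
      min_le_left _ _, fun x y hx hd hy => ?_⟩
    have h1 := hax (A + T + 1) (by positivity) x hx
      (hd.trans_le ((min_le_right _ _).trans (min_le_right _ _)))
    have h2 := hay y hy
    have hd' := hd.trans_le ((min_le_right _ _).trans (min_le_left _ _))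
    have h3 : dist θ c / 2 ≤ dist x c := by
      have := dist_triangle θ x c
      rw [dist_comm θ x] at this
      linarith
    have h4 : √P₀ / dist x c ≤ A := by rw [hA]; gcongr
    have h5 : 0 ≤ √P₀ / dist x c := by positivity
    exact sub_le_sub (hF.antitone (by linarith)) (hF.antitone (by linarith))

namespace Splitting

variable {M : ℕ} {Z : Splitting M}

/-- The detection rates of the sensors in the region of the target exceed those of the sensors in
any other region, in total by a positive multiple of the number of sensors near the target. -/
lemma exists_sum_gap {F : ℝ → ℝ} (hF : StrictAnti F) {P₀ : ℝ} (hP₀ : 0 < P₀) {k kmax : ℕ}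
    (hk : k ≤ kmax) {j : Fin M} {θ : Plane} (hθ : θ ∈ Z.region k j) :
    ∃ δ > 0, ∃ ε > 0, ∀ (N : ℕ) (L : Fin N → Plane), (∀ i, L i ∈ Z.roi₀) → (∀ i, L i ≠ θ) →
      Z.SymmetricPairing P₀ kmax L → ∀ l ≠ j,
        δ * (Nat.card {i : Fin N // dist (L i) θ < ε} : ℝ) ≤
          ∑ i ∈ Z.sensors L k j, F (Z.threshold P₀ k (L i) - amplitude P₀ θ (L i))
            - ∑ i ∈ Z.sensors L k l, F (Z.threshold P₀ k (L i) - amplitude P₀ θ (L i)) := by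
  classical
  obtain ⟨r, hr, hball⟩ := Z.exists_ball_subset_region hθ
  obtain ⟨δ, hδ, ε, hε, hεr, hgap⟩ := exists_tail_gap hF hP₀ θ (Z.center k j) hr
  refine ⟨δ, hδ, ε, hε, fun N L hL hLθ hsym l hl => ?_⟩
  obtain ⟨f, hf⟩ := hsym k hk j l hl θ hθ
  set g : Fin N → ℝ := fun i => F (Z.threshold P₀ k (L i) - amplitude P₀ θ (L i)) with hg
  have hsum : ∑ i ∈ Z.sensors L k l, g i = ∑ i : Z.sensors L k j, g (f i) := by
    rw [← Finset.sum_coe_sort, ← f.sum_comp]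
  have hsum' : ∑ i ∈ Z.sensors L k j, g i = ∑ i : Z.sensors L k j, g i :=
    (Finset.sum_coe_sort _ _).symm
  -- Every pair contributes nonnegatively, and a pair whose first sensor is near the target
  -- contributes at least δ. In the second case the partner is in region `l`, so it cannot be within
  -- `r` of the target.
  have hterm : ∀ i : Z.sensors L k j,
      (if dist (L i) θ < ε then δ else 0) ≤ g i - g (f i) := by
    intro i
    obtain ⟨hthr, hdist⟩ := hf i
    simp only [hg]
    rw [← hthr]
    have hi := Z.mem_sensors.1 i.2
    split_ifs with hd
    · rw [Z.threshold_of_mem_region P₀ hi]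
      refine hgap _ _ (hLθ _) hd (le_of_not_gt fun hlt => ?_)
      exact hl (Z.eq_of_mem_region (Z.mem_sensors.1 (f i).2) (hball _ (hL _) hlt))
    · refine sub_nonneg.2 (hF.antitone (sub_le_sub_left ?_ _))
      have hpos : 0 < dist θ (L i) := dist_pos.2 (hLθ _).symm
      unfold amplitude
      gcongr
  -- As ε ≤ r, all sensors near the target belong to region `j`, so none escapes the pairing.
  have hcard : (Nat.card {i : Fin N // dist (L i) θ < ε} : ℝ) * δ
      = ∑ i : Z.sensors L k j, if dist (L i) θ < ε then δ else 0 := by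
    rw [Finset.sum_coe_sort (Z.sensors L k j) (fun i => if dist (L i) θ < ε then δ else 0),
      ← Finset.sum_filter, Finset.sum_const, nsmul_eq_mul, Nat.card_eq_fintype_card,
      Fintype.card_subtype]
    congr 3
    ext i
    simp only [Finset.mem_filter, Finset.mem_univ, true_and]
    exact ⟨fun h => ⟨Z.mem_sensors.2 (hball _ (hL i) (h.trans_le hεr)), h⟩, fun h => h.2⟩
  rw [mul_comm, hcard, hsum, hsum', ← Finset.sum_sub_distrib]
  exact Finset.sum_le_sum fun i _ => hterm i

end Splitting

/-! ### The conditional probability of a correct decision -/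

section Decision

variable {S : Model} {M N : ℕ} {Z : Splitting M} {L : Fin N → Plane} {k : ℕ} {j : Fin M}

lemma measurable_reward_sensorReliability (hσh : 0 < S.σh2) :
    Measurable fun p : Plane × (Fin N → Sample) => reward Z L k j fun i =>
      S.sensorReliability (amplitude S.P₀ p.1 (L i)) (Z.threshold S.P₀ k (L i)) (p.2 i) := by
  refine (measurable_reward Z L k j).comp (measurable_pi_lambda _ fun i => ?_)
  have h1 : Measurable fun p : Plane × (Fin N → Sample) => amplitude S.P₀ p.1 (L i) := by
    unfold amplitude
    fun_prop
  have h2 : Measurable fun p : Plane × (Fin N → Sample) => p.2 i := by fun_prop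
  have h3 := (Model.measurable_sensorReliability hσh (Z.threshold S.P₀ k (L i))).comp
    (h1.prodMk h2)
  simp only [Function.comp_def] at h3
  exact h3

lemma measurable_reward_sensorReliability_right (hσh : 0 < S.σh2) (θ : Plane) :
    Measurable fun ω : Fin N → Sample => reward Z L k j fun i =>
      S.sensorReliability (amplitude S.P₀ θ (L i)) (Z.threshold S.P₀ k (L i)) (ω i) := by
  have h : Measurable fun ω : Fin N → Sample => (θ, ω) := measurable_const.prodMk measurable_id
  have h' := (measurable_reward_sensorReliability (Z := Z) (L := L) (k := k) (j := j) hσh).comp h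
  simp only [Function.comp_def] at h'
  exact h'

lemma integrable_reward_sensorReliability (hprob : IsProbabilityMeasure S.sampleLaw)
    (hσh : 0 < S.σh2) (θ : Plane) :
    Integrable (fun ω : Fin N → Sample => reward Z L k j fun i =>
      S.sensorReliability (amplitude S.P₀ θ (L i)) (Z.threshold S.P₀ k (L i)) (ω i))
      (Measure.pi fun _ => S.sampleLaw) := by
  refine Integrable.of_bound (C := 1)
    (measurable_reward_sensorReliability_right hσh θ).aestronglyMeasurable
    (ae_of_all _ fun ω => ?_)
  rw [Real.norm_of_nonneg (reward_nonneg _ _ _ _ _)]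
  exact reward_le_one _ _ _ _ _

lemma decideProb_eq (θ : Plane) :
    decideProb S Z L k j θ = ∫ ω : Fin N → Sample, reward Z L k j (fun i =>
      S.sensorReliability (amplitude S.P₀ θ (L i)) (Z.threshold S.P₀ k (L i)) (ω i))
      ∂(Measure.pi fun _ => S.sampleLaw) := rfl

lemma measurable_decideProb (hprob : IsProbabilityMeasure S.sampleLaw) (hσh : 0 < S.σh2) :
    Measurable (decideProb S Z L k j) := by
  have h : StronglyMeasurable fun θ => ∫ ω : Fin N → Sample, reward Z L k j (fun i =>
      S.sensorReliability (amplitude S.P₀ θ (L i)) (Z.threshold S.P₀ k (L i)) (ω i))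
      ∂(Measure.pi fun _ => S.sampleLaw) :=
    StronglyMeasurable.integral_prod_right
      (measurable_reward_sensorReliability hσh).stronglyMeasurable
  exact h.measurable

lemma decideProb_nonneg (θ : Plane) : 0 ≤ decideProb S Z L k j θ :=
  integral_nonneg fun _ => reward_nonneg _ _ _ _ _

lemma decideProb_le_one (hprob : IsProbabilityMeasure S.sampleLaw) (hσh : 0 < S.σh2)
    (θ : Plane) : decideProb S Z L k j θ ≤ 1 := by
  rw [decideProb_eq]
  have := integral_mono (integrable_reward_sensorReliability (Z := Z) (L := L) (k := k) (j := j)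
    hprob hσh θ) (integrable_const 1) fun ω => reward_le_one _ _ _ _ _
  simpa using this

/-- A lower bound for the probability of a correct decision from the gaps between the mean total
reliabilities of the regions. -/
lemma one_sub_le_decideProb (hprob : IsProbabilityMeasure S.sampleLaw) (hσh : 0 < S.σh2)
    (hmem : ∀ a η, MemLp (S.sensorReliability a η) 2 S.sampleLaw) {V : ℝ}
    (hV : ∀ a η, Var[S.sensorReliability a η; S.sampleLaw] ≤ V) {θ : Plane} {t : ℝ} (ht : 0 < t)
    (hmean : ∀ l ≠ j, t ≤
      ∑ i ∈ Z.sensors L k l, ∫ ω, S.sensorReliability (amplitude S.P₀ θ (L i))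
        (Z.threshold S.P₀ k (L i)) ω ∂S.sampleLaw
      - ∑ i ∈ Z.sensors L k j, ∫ ω, S.sensorReliability (amplitude S.P₀ θ (L i))
        (Z.threshold S.P₀ k (L i)) ω ∂S.sampleLaw) :
    1 - M * (N * V / t ^ 2) ≤ decideProb S Z L k j θ := by
  classical
  set μ : Measure (Fin N → Sample) := Measure.pi fun _ => S.sampleLaw with hμ
  set X : Fin N → Sample → ℝ := fun i =>
    S.sensorReliability (amplitude S.P₀ θ (L i)) (Z.threshold S.P₀ k (L i)) with hX
  -- With these coefficients in {-1, 0, 1}, the signed sum is the total of region `l` minus that of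
  -- region `j`, and `E l` is the event that `j` does not strictly beat `l`.
  set c : Fin M → Fin N → ℝ := fun l i =>
    (if i ∈ Z.sensors L k l then 1 else 0) - (if i ∈ Z.sensors L k j then 1 else 0) with hc
  have hcsum : ∀ l (x : Fin N → ℝ), ∑ i, c l i * x i
      = ∑ i ∈ Z.sensors L k l, x i - ∑ i ∈ Z.sensors L k j, x i := by
    intro l x
    simp [hc, sub_mul]
  have hV0 : 0 ≤ V := (variance_nonneg _ _).trans (hV 0 0)
  set E : Fin M → Set (Fin N → Sample) := fun l => {ω | ∑ i, c l i * X i (ω i) ≤ 0} with hE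
  have hXmeas : ∀ i, Measurable (X i) := fun i => Model.measurable_sensorReliability_right hσh _ _
  have hEmeas : ∀ l, MeasurableSet (E l) := fun l => measurableSet_le
    (Finset.measurable_fun_sum _ fun i _ =>
      ((hXmeas i).comp (measurable_pi_apply i)).const_mul _) measurable_const
  have hEle : ∀ l ≠ j, μ.real (E l) ≤ N * V / t ^ 2 := by
    intro l hl
    refine measureReal_sum_nonpos_le (fun i => hmem _ _) (fun i => hV _ _) (fun i => ?_) ht ?_
    · simp only [hc]
      split_ifs <;> norm_num
    · rw [hcsum l fun i => ∫ ω, X i ω ∂S.sampleLaw]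
      exact hmean l hl
  -- This is the union bound, obtained by integrating a pointwise lower bound on the reward: outside
  -- all `E l` the reward is 1, and elsewhere the bound is at most 0.
  have hbad : 1 - ∑ l ∈ Finset.univ.erase j, μ.real (E l) ≤ decideProb S Z L k j θ := by
    have hind : ∀ l, Integrable ((E l).indicator fun _ => (1 : ℝ)) μ := fun l =>
      (integrable_const _).indicator (hEmeas l)
    have hint : Integrable (fun ω => 1 - ∑ l ∈ Finset.univ.erase j,
        (E l).indicator (fun _ => (1 : ℝ)) ω) μ :=
      (integrable_const _).sub (integrable_finsetSum _ fun l _ => hind l)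
    have hle := integral_mono hint (integrable_reward_sensorReliability
      (Z := Z) (L := L) (k := k) (j := j) hprob hσh θ) fun ω => by
      simp only
      by_cases h : ∀ l ≠ j, ω ∉ E l
      · rw [reward_eq_one]
        · exact sub_le_self _ (Finset.sum_nonneg fun l _ =>
            Set.indicator_nonneg (fun _ _ => zero_le_one) _)
        · intro l hl
          have := h l hl
          simp only [hE, Set.mem_ofPred_eq, not_le] at this
          rw [hcsum l fun i => X i (ω i)] at this
          exact sub_pos.1 this
      · push Not at h
        obtain ⟨l, hl, hωl⟩ := h
        have h1 : (1 : ℝ) ≤ ∑ l ∈ Finset.univ.erase j, (E l).indicator (fun _ => (1 : ℝ)) ω := by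
          have := Finset.single_le_sum (f := fun l => (E l).indicator (fun _ => (1 : ℝ)) ω)
            (fun l _ => Set.indicator_nonneg (fun _ _ => zero_le_one) _)
            (Finset.mem_erase.2 ⟨hl, Finset.mem_univ l⟩)
          simpa [hωl] using this
        exact (by linarith : _ ≤ (0 : ℝ)).trans (reward_nonneg _ _ _ _ _)
    rw [integral_sub (integrable_const _) (integrable_finsetSum _ fun l _ => hind l),
      integral_finsetSum _ fun l _ => hind l] at hle
    simpa [integral_indicator_const _ (hEmeas _), decideProb_eq, ← hμ] using hle
  have hsum : ∑ l ∈ Finset.univ.erase j, μ.real (E l) ≤ M * (N * V / t ^ 2) :=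
    calc ∑ l ∈ Finset.univ.erase j, μ.real (E l)
        ≤ ∑ _l ∈ Finset.univ.erase j, N * V / t ^ 2 :=
          Finset.sum_le_sum fun l hl => hEle l (Finset.ne_of_mem_erase hl)
      _ ≤ ∑ _l : Fin M, N * V / t ^ 2 :=
          Finset.sum_le_sum_of_subset_of_nonneg (Finset.erase_subset _ _)
            fun _ _ _ => by positivity
      _ = M * (N * V / t ^ 2) := by simp
  linarith

end Decision

/-! ### The limit of the detection probability -/

section Limit

variable {S : Model} {M kmax : ℕ} {Z : Splitting M} {N : ℕ → ℕ}
  {L : (m : ℕ) → Fin (N m) → Plane} {k : ℕ} {j : Fin M}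

/-- The mean gap is at least κδcN and the variance at most VN, so the error is O(1/N). The constants
δ, ε and c depend on θ, hence convergence is only pointwise. -/
lemma tendsto_decideProb (hP₀ : 0 < S.P₀) (hα₀ : 0 ≤ S.α) (hα : S.α < 1 / 2) (hEb : 0 < S.Eb)
    (hσh : 0 < S.σh2) (hσf : 0 < S.σf2) (hnoise : IsProbabilityMeasure S.noise)
    (hF : StrictAnti fun x : ℝ => S.noise.real (Set.Ioi x)) (hN : Tendsto N atTop atTop)
    (hroi : ∀ m i, L m i ∈ Z.roi₀)
    (hdense : ∀ x ∈ Z.roi₀, ∀ ε > 0, ∃ c : ℝ, 0 < c ∧ ∀ᶠ m in atTop,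
      c * (N m : ℝ) ≤ (Nat.card {i : Fin (N m) // dist (L m i) x < ε} : ℝ))
    (hsym : ∀ m, Z.SymmetricPairing S.P₀ kmax (L m)) (hk : k ≤ kmax) {θ : Plane}
    (hθ : θ ∈ Z.region k j) (hLθ : ∀ m i, L m i ≠ θ) :
    Tendsto (fun m => decideProb S Z (L m) k j θ) atTop (𝓝 1) := by
  have hα1 : S.α ≤ 1 := by linarith
  have hprob := Model.isProbabilityMeasure_sampleLaw hα₀ hα1 hσh hnoise
  obtain ⟨V, hV⟩ := Model.exists_variance_sensorReliability_le hα₀ hα1 hσh hσf hnoise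
  obtain ⟨δ, hδ, ε, hε, hgap⟩ := Splitting.exists_sum_gap hF hP₀ hk hθ
  obtain ⟨c, hc, hcount⟩ := hdense θ (Z.region_subset_roi₀ k j hθ) ε hε
  set κ := 2 * S.meanReliability * (1 - 2 * S.α) with hκ
  have hκpos : 0 < κ :=
    mul_pos (mul_pos two_pos (Model.meanReliability_pos hEb hσh hσf)) (by linarith)
  have hlower : ∀ᶠ m in atTop,
      1 - M * (V / (κ * δ * c) ^ 2) / (N m : ℝ) ≤ decideProb S Z (L m) k j θ := by
    filter_upwards [hcount, hN.eventually_gt_atTop 0] with m hm hNm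
    have hNpos : (0 : ℝ) < N m := by exact_mod_cast hNm
    have := one_sub_le_decideProb (S := S) (Z := Z) (L := L m) (k := k) (j := j) (θ := θ)
      (t := κ * δ * c * N m) hprob hσh
      (Model.memLp_sensorReliability hα₀ hα1 hσh hσf hnoise) hV (by positivity) fun l hl => by
        have h := hgap (N m) (L m) (hroi m) (hLθ m) (hsym m) l hl
        obtain ⟨f, -⟩ := hsym m k hk j l hl θ hθ
        -- Equal numbers of sensors make the constant terms of the mean reliabilities cancel,
        -- leaving the difference of detection rates times κ.
        have hcardeq : ((Z.sensors (L m) k j).card : ℝ) = (Z.sensors (L m) k l).card := by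
          exact_mod_cast Finset.card_eq_of_equiv f
        simp_rw [Model.integral_sensorReliability hα₀ hα1 hσh hσf hnoise]
        rw [← Finset.mul_sum, ← Finset.mul_sum, Finset.sum_sub_distrib, Finset.sum_sub_distrib,
          ← Finset.mul_sum, ← Finset.mul_sum]
        simp only [Finset.sum_const, nsmul_eq_mul, mul_one]
        rw [hcardeq]
        calc κ * δ * c * N m = κ * (δ * (c * N m)) := by ring
          _ ≤ κ * (δ * (Nat.card {i : Fin (N m) // dist (L m i) θ < ε} : ℝ)) := by gcongr
          _ ≤ κ * _ := mul_le_mul_of_nonneg_left h hκpos.le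
          _ = _ := by rw [hκ]; ring
    convert this using 2
    field_simp
  refine tendsto_of_tendsto_of_tendsto_of_le_of_le' ?_ tendsto_const_nhds hlower
    (Eventually.of_forall fun m => decideProb_le_one hprob hσh θ)
  have hinv := (tendsto_natCast_atTop_atTop (R := ℝ)).comp hN
  simpa using (hinv.const_div_atTop (M * (V / (κ * δ * c) ^ 2))).const_sub 1

/-- Dominated convergence with bound 1 makes up for the lack of uniformity in θ. There are countably
many sensor locations in the whole sequence, so almost every θ avoids all of them. -/
lemma tendsto_detectionProbAt (hprob : IsProbabilityMeasure S.sampleLaw) (hσh : 0 < S.σh2)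
    (π : Measure Plane) [IsProbabilityMeasure π] (hmeas : ∀ j, MeasurableSet (Z.region k j))
    (hπ : ∀ j, π (Z.region k j) ≠ 0) (htarget : ∀ m i, π {L m i} = 0)
    (hlim : ∀ j, ∀ θ ∈ Z.region k j, (∀ m i, L m i ≠ θ) →
      Tendsto (fun m => decideProb S Z (L m) k j θ) atTop (𝓝 1)) :
    Tendsto (fun m => detectionProbAt S Z π (L m) k) atTop (𝓝 1) := by
  have hM : (M : ℝ) ≠ 0 := by
    exact_mod_cast ((Nat.zero_le _).trans_lt (Z.path 0).2).ne'
  have hj : ∀ j, Tendsto (fun m => ∫ θ, decideProb S Z (L m) k j θ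
      ∂(ProbabilityTheory.cond π (Z.region k j))) atTop (𝓝 1) := by
    intro j
    have := cond_isProbabilityMeasure (hπ j)
    have hone : (1 : ℝ) = ∫ _θ, (1 : ℝ) ∂(ProbabilityTheory.cond π (Z.region k j)) := by simp
    rw [hone]
    refine tendsto_integral_of_dominated_convergence (fun _ => 1)
      (fun m => (measurable_decideProb hprob hσh).aestronglyMeasurable) (integrable_const 1)
      (fun m => ae_of_all _ fun θ => ?_) ?_
    · rw [Real.norm_of_nonneg (decideProb_nonneg θ)]
      exact decideProb_le_one hprob hσh θ
    · have hL : ∀ᵐ θ ∂(ProbabilityTheory.cond π (Z.region k j)), ∀ m i, L m i ≠ θ := by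
        refine cond_absolutelyContinuous.ae_le (ae_all_iff.2 fun m => ae_all_iff.2 fun i => ?_)
        filter_upwards [measure_eq_zero_iff_ae_notMem.1 (htarget m i)] with θ h h'
        exact h h'.symm
      filter_upwards [ae_cond_mem (hmeas j), hL] with θ h1 h2
      exact hlim j θ h1 h2
  have := (tendsto_finsetSum Finset.univ fun j _ => hj j).const_mul (1 / (M : ℝ))
  simpa [detectionProbAt, hM] using this

end Limit

end TargetLocalization

theorem theorem4 (S : TargetLocalization.Model)
    (hP₀ : 0 < S.P₀) (hα₀ : 0 ≤ S.α) (hα : S.α < 1 / 2) (hEb : 0 < S.Eb)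
    (hσh : 0 < S.σh2) (hσf : 0 < S.σf2)
    (hnoise : IsProbabilityMeasure S.noise)
    -- the complementary distribution function of the sensor noise is strictly decreasing
    (hF : StrictAnti fun x : ℝ => S.noise.real (Set.Ioi x))
    (M kmax : ℕ) (Z : TargetLocalization.Splitting M)
    (hroi : MeasurableSet Z.roi₀)
    -- the law of the target: all regions of an iteration are equally likely
    (π : Measure TargetLocalization.Plane) (hπ : IsProbabilityMeasure π)
    (hprior : ∀ k ≤ kmax, ∀ j : Fin M, π.real (Z.region k j) = 1 / (M : ℝ) ^ (k + 1))
    -- a sequence of networks whose number of sensors tends to infinity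
    (N : ℕ → ℕ) (hN : Tendsto N atTop atTop)
    (L : (m : ℕ) → Fin (N m) → TargetLocalization.Plane)
    -- the regions of an iteration contain equally many sensors
    (hcard : ∀ m, ∀ k ≤ kmax, ∀ j : Fin M,
      (Z.sensors (L m) k j).card * M ^ (k + 1) = N m)
    -- amplitudes and thresholds are finite
    (htarget : ∀ m i, π {L m i} = 0)
    (hcenter : ∀ m, ∀ k ≤ kmax, ∀ j : Fin M, ∀ i ∈ Z.sensors (L m) k j,
      L m i ≠ Z.center k j)
    -- the sensors fill the initial region of interest with positive asymptotic density
    (hdense : ∀ x ∈ Z.roi₀, ∀ ε > 0, ∃ c : ℝ, 0 < c ∧ ∀ᶠ m in atTop,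
      c * (N m : ℝ) ≤ (Nat.card {i : Fin (N m) // dist (L m i) x < ε} : ℝ))
    -- the symmetry assumption
    (hsym : ∀ m, Z.SymmetricPairing S.P₀ kmax (L m)) :
    Tendsto (fun m => TargetLocalization.detectionProb S Z π kmax (L m)) atTop (𝓝 1) := by
  have hprob := TargetLocalization.Model.isProbabilityMeasure_sampleLaw hα₀ (by linarith) hσh hnoise
  have hM : (0 : ℝ) < M := by
    exact_mod_cast (Nat.zero_le _).trans_lt (Z.path 0).2
  have hL : ∀ m i, L m i ∈ Z.roi₀ := fun m =>
    Z.mem_roi₀_of_card_sensors (hcard m 0 (Nat.zero_le _))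
  rw [show (1 : ℝ) = ∏ _k ∈ Finset.range (kmax + 1), (1 : ℝ) by simp]
  refine tendsto_finsetProd _ fun k hk => ?_
  have hk' : k ≤ kmax := Nat.lt_succ_iff.1 (Finset.mem_range.1 hk)
  refine TargetLocalization.tendsto_detectionProbAt hprob hσh π
    (fun j => Z.measurableSet_region hroi k j) (fun j h0 => ?_) htarget fun j θ hθ hLθ =>
    TargetLocalization.tendsto_decideProb hP₀ hα₀ hα hEb hσh hσf hnoise hF hN hL hdense hsym hk'
      hθ hLθ
  -- Positive prior mass makes conditioning on the region yield a probability measure.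
  have h := hprior k hk' j
  rw [measureReal_def, h0, ENNReal.toReal_zero] at h
  exact (by positivity : (0 : ℝ) < 1 / (M : ℝ) ^ (k + 1)).ne h
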